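/- Let $\Sigma$ be an alphabet with exactly two letters. For $k\in\mathbb N_0$, words $u,v\in\Sigma^*$ are Simon $k$-congruent, $u\sim_k v$, if they have the same scattered factors (subsequences) of length at most $k$. An arch is a word over $\Sigma$ that contains every letter of $\Sigma$ and whose last letter occurs exactly once in it. Every $w\in\Sigma^*$ has a unique factorization $w=a_1\cdots a_m r$ in which $a_1,\dots,a_m$ are arches ($m\ge 0$) and $r$ does not contain all letters of $\Sigma$; one says that $w$ has $m$ arches. Let the numbers $c_k^m$, for integers $k$ and $m\ge -1$, be given by $c_k^{-1}=1$, $c_k^0=2k+1$ and $$c_k^m = 2(k-m+1)\,c_{k-1}^{m-1}-2(k-m)\,c_{k-2}^{m-2}\qquad(m\ge 1).$$ Theorem. For all integers $0\le m<k$, the number of $\sim_k$-classes of words over $\Sigma$ with exactly $m$ arches is finite and equals $$\left\lVert\begin{pmatrix}k-m&k-m&k-m\\1&2&1\\k-m&k-m&k-m\end{pmatrix}^{m}\begin{pmatrix}k-m\\1\\k-m\end{pmatrix}\right\rVert_1=c_k^m,$$ where $\lVert\cdot\rVert_1$ denotes the $1$-norm (the sum of the absolute values of the entries). -/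

import Mathlib

/-- The set `ScatFact_{≤k}(w)` of scattered factors (subsequences) of `w` of length at most `k`. -/
def scatFactLE {A : Type*} (k : ℕ) (w : List A) : Set (List A) :=
  {u | u.Sublist w ∧ u.length ≤ k}

/-- Simon's congruence `∼_k`, as an equivalence relation on words over `A`. -/
def simonSetoid (A : Type*) (k : ℕ) : Setoid (List A) :=
  Setoid.ker (scatFactLE k)

/-- An arch over the alphabet `A`: a word that contains every letter of `A` and whose last letter
occurs exactly once in it. -/
def IsArch {A : Type*} (a : List A) : Prop :=
  (∀ y : A, y ∈ a) ∧ ∃ (u : List A) (x : A), a = u ++ [x] ∧ x ∉ u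

/-- `(arches, rest)` is the arch factorization of `w` over the alphabet `A`: the word `w` is the
concatenation of the arches and the rest, and the rest misses some letter of `A`. -/
structure IsArchFactorization {A : Type*} (w : List A) (arches : List (List A)) (rest : List A) :
    Prop where
  eq_append : w = arches.flatten ++ rest
  isArch : ∀ a ∈ arches, IsArch a
  rest_missing : ∃ y : A, y ∉ rest

/-- The word `w` over the alphabet `A` has exactly `m` arches. -/
def HasArches {A : Type*} (w : List A) (m : ℕ) : Prop :=
  ∃ (arches : List (List A)) (rest : List A),
    IsArchFactorization w arches rest ∧ arches.length = m

/-- The congruence classes of `∼_k` of words with `m` arches. -/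
def simonClasses (A : Type*) (k m : ℕ) : Set (Quotient (simonSetoid A k)) :=
  {q | ∃ w : List A, HasArches w m ∧ Quotient.mk (simonSetoid A k) w = q}

/-- The numbers `c_k^m` with the upper index shifted by one, `archRecAux k j = c_k^{j-1}`. -/
def archRecAux : ℤ → ℕ → ℤ
  | _, 0 => 1
  | k, 1 => 2 * k + 1
  | k, j + 2 =>
      2 * (k - (j + 1) + 1) * archRecAux (k - 1) (j + 1) - 2 * (k - (j + 1)) * archRecAux (k - 2) j

/-- The numbers `c_k^m`, for an integer `k` and an integer `m ≥ -1`; see the three facts below,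
which determine them. -/
def archRec (k m : ℤ) : ℤ :=
  archRecAux k (m + 1).toNat

theorem archRec_neg_one (k : ℤ) : archRec k (-1) = 1 := by
  simp [archRec, archRecAux]

theorem archRec_zero (k : ℤ) : archRec k 0 = 2 * k + 1 := by
  simp [archRec, archRecAux]

theorem archRec_rec (k m : ℤ) (hm : 1 ≤ m) :
    archRec k m =
      2 * (k - m + 1) * archRec (k - 1) (m - 1) - 2 * (k - m) * archRec (k - 2) (m - 2) := by
  obtain ⟨j, rfl⟩ : ∃ j : ℕ, m = (j : ℤ) + 1 := ⟨(m - 1).toNat, by omega⟩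
  have h1 : ((j : ℤ) + 1 + 1).toNat = j + 2 := by omega
  have h2 : ((j : ℤ) + 1 - 1 + 1).toNat = j + 1 := by omega
  have h3 : ((j : ℤ) + 1 - 2 + 1).toNat = j := by omega
  simp only [archRec, h1, h2, h3, archRecAux]

/-- The matrix `D_{k,m}`. -/
def archMatrix (k m : ℕ) : Matrix (Fin 3) (Fin 3) ℝ :=
  !![(k : ℝ) - m, (k : ℝ) - m, (k : ℝ) - m;
     1, 2, 1;
     (k : ℝ) - m, (k : ℝ) - m, (k : ℝ) - m]

/-- The vector `(k - m, 1, k - m)ᵀ`. -/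
def archVector (k m : ℕ) : Fin 3 → ℝ :=
  ![(k : ℝ) - m, 1, (k : ℝ) - m]

/-! Put t = k - m. Each class of words with m arches contains the word of exactly one normal form:
an alternating sequence of m + 1 blocks (empty, or a power of a letter with exponent at most t) and
m short links. Existence (`NormalForm.exists_scatFactLE_eq`): peel off the first arch and normalize
the tail. Prepending an arch raises the order of a congruence by one, and exponents above t are
invisible because everything after the block already contains all words whose length is the number
of remaining links. Uniqueness (`NormalForm.eq_of_scatFactLE_eq`): some word of length m has a
rightmost embedding that leaves exactly the first block free, so the class determines that block.
Cancelling the first arch determines the tail by induction, and the link between them is then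
determined as well. Counting normal forms by the shape of the first block is a transfer matrix
computation (`archMatrix_pow_mulVec`). Eliminating the count for an empty first block leaves a
recurrence of order two for the total, which is that of c_k^m along constant k - m
(`NormalForm.archRecAux_eq_card`). -/

/-! ### Scattered factors -/

/-- If `r` does not occur in `z`, then in any embedding into `X ++ r :: z` the last letter `r` of
`v ++ [r]` leaves `v` embedded in `X`. -/
theorem List.Sublist.of_append_singleton_of_notMem {A : Type*} {v X z : List A} {r : A}
    (hr : r ∉ z) (h : (v ++ [r]).Sublist (X ++ r :: z)) : v.Sublist X := by
  have h' := h.reverse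
  simp only [List.reverse_append, List.reverse_cons, List.reverse_nil, List.nil_append,
    List.singleton_append, List.append_assoc] at h'
  have key : ∀ (y X v : List A), r ∉ y → (r :: v).Sublist (y ++ r :: X) → v.Sublist X := by
    intro y X v hy hs
    induction y with
    | nil => simpa using hs
    | cons a y ih =>
      simp only [List.mem_cons, not_or] at hy
      rw [List.cons_append] at hs
      cases hs with
      | cons _ hs => exact ih hy.2 hs
      | cons_cons _ hs => exact absurd rfl hy.1
  simpa using (key z.reverse X.reverse v.reverse (by simpa using hr) h').reverse

theorem List.Sublist.of_cons_append_of_notMem {A : Type*} {v X z : List A} {r : A}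
    (hr : r ∉ z) (h : (r :: v).Sublist (z ++ r :: X)) : v.Sublist X := by
  have h' := h.reverse
  simp only [List.reverse_append, List.reverse_cons, List.append_assoc,
    List.singleton_append] at h'
  simpa using (List.Sublist.of_append_singleton_of_notMem (by simpa using hr) h').reverse

/-- Prepending a word that contains all letters raises the order of the congruence by one. -/
theorem scatFactLE_append_subset {A : Type*} {k : ℕ} {a w w' : List A} (ha : ∀ y : A, y ∈ a)
    (h : scatFactLE k w ⊆ scatFactLE k w') :
    scatFactLE (k + 1) (a ++ w) ⊆ scatFactLE (k + 1) (a ++ w') := by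
  rintro u ⟨hu, hlen⟩
  refine ⟨?_, hlen⟩
  obtain ⟨p, q, rfl, hp, hq⟩ := List.sublist_append_iff.1 hu
  -- If `a` receives no letter of `u`, the first letter can be moved into `a`, which contains it. In
  -- both cases at most `k` letters are left for `w`.
  cases p with
  | nil =>
    cases q with
    | nil => simp
    | cons x q =>
      have hq' := h ⟨(List.sublist_cons_self x q).trans hq, by simpa using hlen⟩
      simpa using (List.singleton_sublist.2 (ha x)).append hq'.1
  | cons x p =>
    have hq' := h ⟨hq, by simp at hlen; omega⟩
    exact hp.append hq'.1

theorem scatFactLE_append_congr {A : Type*} {k : ℕ} {a w w' : List A} (ha : ∀ y : A, y ∈ a)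
    (h : scatFactLE k w = scatFactLE k w') :
    scatFactLE (k + 1) (a ++ w) = scatFactLE (k + 1) (a ++ w') :=
  (scatFactLE_append_subset ha h.le).antisymm (scatFactLE_append_subset ha h.ge)

/-- Deleting the first arch lowers the order of the inclusion of scattered factors by one. -/
theorem scatFactLE_subset_of_isArch_append {A : Type*} {k : ℕ} {a a' w w' : List A}
    (ha : IsArch a) (ha' : IsArch a')
    (h : scatFactLE (k + 1) (a ++ w) ⊆ scatFactLE (k + 1) (a' ++ w')) :
    scatFactLE k w ⊆ scatFactLE k w' := by
  obtain ⟨-, u', x, rfl, hx⟩ := ha'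
  rintro u ⟨hu, hlen⟩
  refine ⟨?_, hlen⟩
  -- The added letter `x` is the one that ends the arch `a'` and occurs only there, so matching it
  -- uses up all of `a'`.
  have h1 : (x :: u) ∈ scatFactLE (k + 1) (a ++ w) :=
    ⟨by simpa using (List.singleton_sublist.2 (ha.1 x)).append hu, by simpa using hlen⟩
  have h2 := (h h1).1
  rw [List.append_assoc, List.singleton_append] at h2
  exact h2.of_cons_append_of_notMem hx

theorem scatFactLE_of_isArch_append {A : Type*} {k : ℕ} {a a' w w' : List A}
    (ha : IsArch a) (ha' : IsArch a')
    (h : scatFactLE (k + 1) (a ++ w) = scatFactLE (k + 1) (a' ++ w')) :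
    scatFactLE k w = scatFactLE k w' :=
  (scatFactLE_subset_of_isArch_append ha ha' h.le).antisymm
    (scatFactLE_subset_of_isArch_append ha' ha h.ge)

/-- Words of length at most `k` are determined by their class modulo `∼_k`. -/
theorem eq_of_scatFactLE_eq {A : Type*} {k : ℕ} {u v : List A} (hu : u.length ≤ k)
    (hv : v.length ≤ k) (h : scatFactLE k u = scatFactLE k v) : u = v :=
  (h.le ⟨List.Sublist.refl u, hu⟩).1.antisymm (h.ge ⟨List.Sublist.refl v, hv⟩).1

/-- In front of a word containing all words of length `m`, powers of a letter may be truncated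
at the exponent `t` without changing the class modulo `∼_{m+t}`. -/
theorem scatFactLE_replicate_append {A : Type*} {m t i j : ℕ} {x : A} {S : List A}
    (hS : ∀ s : List A, s.length = m → s.Sublist S) (htj : t ≤ j) (hji : j ≤ i) :
    scatFactLE (m + t) (List.replicate i x ++ S) =
      scatFactLE (m + t) (List.replicate j x ++ S) := by
  have hS' : ∀ s : List A, s.length ≤ m → s.Sublist S := fun s hs =>
    (List.sublist_append_left s (List.replicate (m - s.length) x)).trans
      (hS _ (by simp; omega))
  refine Set.Subset.antisymm ?_ ?_
  · rintro u ⟨hu, hlen⟩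
    refine ⟨?_, hlen⟩
    obtain ⟨p, q, rfl, hp, hq⟩ := List.sublist_append_iff.1 hu
    obtain ⟨n, -, rfl⟩ := List.sublist_replicate_iff.1 hp
    rcases le_total n j with hn | hn
    · exact ((List.replicate_sublist_replicate x).2 hn).append hq
    -- The first `j ≥ t` copies of `x` are matched in the power; the at most `m` remaining letters
    -- all fit into `S`.
    · obtain ⟨d, rfl⟩ := Nat.exists_eq_add_of_le hn
      rw [List.replicate_add, List.append_assoc]
      refine (List.Sublist.refl _).append (hS' _ ?_)
      simp at hlen ⊢
      omega
  · rintro u ⟨hu, hlen⟩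
    exact ⟨hu.trans (((List.replicate_sublist_replicate x).2 hji).append (List.Sublist.refl S)),
      hlen⟩

/-! ### Arches -/

theorem HasArches.arch_append {A : Type*} {a w : List A} {m : ℕ} (ha : IsArch a)
    (h : HasArches w m) : HasArches (a ++ w) (m + 1) := by
  obtain ⟨l, r, ⟨rfl, hl, hr⟩, rfl⟩ := h
  exact ⟨a :: l, r, ⟨by simp, by simpa using ⟨ha, hl⟩, hr⟩, by simp⟩

theorem hasArches_zero_iff {A : Type*} {w : List A} : HasArches w 0 ↔ ∃ y, y ∉ w := by
  constructor
  · rintro ⟨l, r, ⟨rfl, -, hr⟩, h0⟩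
    obtain rfl := List.length_eq_zero_iff.1 h0
    simpa using hr
  · exact fun h => ⟨[], w, ⟨by simp, by simp, h⟩, rfl⟩

theorem HasArches.exists_eq_append {A : Type*} {w : List A} {m : ℕ} (h : HasArches w (m + 1)) :
    ∃ a w', w = a ++ w' ∧ IsArch a ∧ HasArches w' m := by
  obtain ⟨l, r, ⟨rfl, hl, hr⟩, hm⟩ := h
  cases l with
  | nil => simp at hm
  | cons a l =>
    simp only [List.mem_cons, forall_eq_or_imp] at hl
    exact ⟨a, l.flatten ++ r, by simp, hl.1, l, r, ⟨rfl, hl.2, hr⟩, by simpa using hm⟩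

/-- Arches and scattered factors are transported along bijections of alphabets, which reduces the
count to words over `Bool`. -/
theorem IsArch.map {A B : Type*} (e : A ≃ B) {a : List A} (h : IsArch a) :
    IsArch (a.map e) := by
  obtain ⟨hall, u, x, rfl, hx⟩ := h
  exact ⟨fun y => List.mem_map.2 ⟨e.symm y, hall _, by simp⟩, u.map e, e x, by simp,
    by simpa using hx⟩

theorem HasArches.map {A B : Type*} (e : A ≃ B) {w : List A} {m : ℕ} (h : HasArches w m) :
    HasArches (w.map e) m := by
  induction m generalizing w with
  | zero =>
    obtain ⟨y, hy⟩ := hasArches_zero_iff.1 h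
    exact hasArches_zero_iff.2 ⟨e y, by simpa using hy⟩
  | succ m ih =>
    obtain ⟨a, w', rfl, ha, hw'⟩ := h.exists_eq_append
    rw [List.map_append]
    exact (ih hw').arch_append (ha.map e)

theorem scatFactLE_map {A B : Type*} (e : A ≃ B) (k : ℕ) (w : List A) :
    scatFactLE k (w.map e) = List.map e '' scatFactLE k w := by
  ext u
  constructor
  · rintro ⟨hu, hlen⟩
    obtain ⟨v, hv, rfl⟩ := List.sublist_map_iff.1 hu
    exact ⟨v, ⟨hv, by simpa using hlen⟩, rfl⟩
  · rintro ⟨v, ⟨hv, hlen⟩, rfl⟩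
    exact ⟨hv.map e, by simpa using hlen⟩

theorem scatFactLE_map_inj {A B : Type*} (e : A ≃ B) {k : ℕ} {w w' : List A} :
    scatFactLE k (w.map e) = scatFactLE k (w'.map e) ↔ scatFactLE k w = scatFactLE k w' := by
  rw [scatFactLE_map, scatFactLE_map]
  exact (List.map_injective_iff.2 e.injective).image_injective.eq_iff

theorem IsArch.exists_eq_replicate {a : List Bool} (h : IsArch a) :
    ∃ (x : Bool) (j : ℕ), a = List.replicate (j + 1) x ++ [!x] := by
  obtain ⟨hall, u, y, rfl, hy⟩ := h
  have hu : u = List.replicate u.length (!y) := List.eq_replicate_iff.2 ⟨rfl, fun b hb => by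
    have : b ≠ y := fun h => hy (h ▸ hb)
    cases b <;> cases y <;> simp_all⟩
  cases u with
  | nil => simpa using hall (!y)
  | cons z u => exact ⟨!y, u.length, by rw [hu]; simp⟩

theorem isArch_replicate_append (x : Bool) (j : ℕ) :
    IsArch (List.replicate (j + 1) x ++ [!x]) :=
  ⟨fun y => by cases x <;> cases y <;> simp, _, _, rfl, by cases x <;> simp⟩

/-! ### Normal forms of binary words

A binary word with `m` arches factorizes as `α₀ β₁ α₁ ⋯ βₘ αₘ`, where the words `αᵢ₋₁ βᵢ` are the
arches read from the left and the words `βᵢ αᵢ` are the arches read from the right. The blocks `αᵢ`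
are powers of a letter; `none` stands for the empty block and `some x` for a nonempty power
of `x`. -/

/-- The blocks of length at most `t` of a given shape. -/
def Block (t : ℕ) : Option Bool → Type
  | none => Unit
  | some _ => Fin t

/-- The possible links between two adjacent blocks of given shapes. -/
def Link : Option Bool → Option Bool → Type
  | none, none => Bool
  | none, some _ => Unit
  | some _, _ => Unit

/-- The alternating sequences of `m + 1` blocks and `m` links that start with a block of a given
shape. -/
def NormalForm (t : ℕ) : ℕ → Option Bool → Type
  | 0, s => Block t s
  | m + 1, s => Block t s × (Σ s', Link s s' × NormalForm t m s')

/-- The shift by one makes the exponents of a nonempty block run from 1 to `t`. -/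
def Block.word {t : ℕ} : {s : Option Bool} → Block t s → List Bool
  | none, _ => []
  | some x, j => List.replicate ((show Fin t from j).val + 1) x

/-- A power of `x` on the left forces the link to end in `!x`, and a power of `y` on the right
forces it to start with `!y`. Next to an empty block the link must itself contain both letters. Only
between two empty blocks does a choice remain. -/
def Link.word : {s s' : Option Bool} → Link s s' → List Bool
  | none, none, b => [b, !b]
  | none, some y, _ => [!y, y]
  | some x, none, _ => [x, !x]
  | some x, some y, _ => if x = y then [!x] else [x, y]

/-- The first block of a normal form. -/
def NormalForm.head {t : ℕ} : {m : ℕ} → {s : Option Bool} → NormalForm t m s → Block t s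
  | 0, _, c => c
  | _ + 1, _, c => c.1

/-- The word of a normal form. -/
def NormalForm.word {t : ℕ} : {m : ℕ} → {s : Option Bool} → NormalForm t m s → List Bool
  | 0, _, c => Block.word c
  | _ + 1, _, c => c.1.word ++ (c.2.2.1.word ++ c.2.2.2.word)

theorem Block.length_word_le {t : ℕ} {s : Option Bool} (b : Block t s) : b.word.length ≤ t := by
  match s, b with
  | none, _ => simp [Block.word]
  | some x, j => simpa [Block.word] using (show Fin t from j).2

theorem Block.exists_notMem_word {t : ℕ} {s : Option Bool} (b : Block t s) :
    ∃ y, y ∉ b.word := by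
  match s, b with
  | none, _ => simp [Block.word]
  | some x, j => exact ⟨!x, by simp [Block.word]⟩

theorem Block.eq_of_word_eq {t : ℕ} {s s' : Option Bool} {b : Block t s} {b' : Block t s'}
    (h : b.word = b'.word) : (⟨s, b⟩ : Σ s, Block t s) = ⟨s', b'⟩ := by
  match s, b, s', b' with
  | none, _, none, _ => rfl
  | none, _, some x, j => simp [Block.word] at h
  | some x, j, none, _ => simp [Block.word] at h
  | some x, i, some y, j =>
    obtain ⟨h1, h2⟩ := by simpa [Block.word, List.replicate_inj] using h
    subst h2
    have : i = j := Fin.ext h1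
    rw [this]

theorem isArch_block_append_link {t : ℕ} {s s' : Option Bool} (b : Block t s) (l : Link s s') :
    IsArch (b.word ++ l.word) := by
  match s, s', b, l with
  | none, none, _, x => exact isArch_replicate_append x 0
  | none, some y, _, _ =>
    have := isArch_replicate_append (!y) 0
    rw [Bool.not_not] at this
    exact this
  | some x, none, j, _ =>
    have := isArch_replicate_append x ((show Fin t from j).val + 1)
    rw [List.replicate_succ', List.append_assoc] at this
    exact this
  | some x, some y, j, _ =>
    by_cases hxy : x = y
    · simpa [Block.word, Link.word, hxy] using isArch_replicate_append y _
    · obtain rfl : y = !x := by cases x <;> cases y <;> simp_all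
      have := isArch_replicate_append x ((show Fin t from j).val + 1)
      rw [List.replicate_succ', List.append_assoc] at this
      simpa [Block.word, Link.word] using this

/-- Together with `mem_link_append_block`, this says that a link followed by its block is an arch
read from the right. -/
theorem exists_link_append_block {t : ℕ} {s s' : Option Bool} (l : Link s s') (b : Block t s') :
    ∃ r z, l.word ++ b.word = r :: z ∧ r ∉ z := by
  match s, s', b, l with
  | none, none, _, x =>
    have hx : ∀ x : Bool, x ∉ [!x] := by simp
    exact ⟨_, _, rfl, hx x⟩
  | none, some y, _, _ => exact ⟨_, _, rfl, by simp [Block.word]⟩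
  | some x, none, j, _ => exact ⟨x, [!x], rfl, by simp⟩
  | some x, some y, j, _ =>
    by_cases hxy : x = y
    · exact ⟨!x, _, by simp [Link.word, hxy]; rfl, by simp [Block.word, hxy]⟩
    · exact ⟨x, _, by simp [Link.word, hxy]; rfl, by simp [Block.word, hxy]⟩

theorem mem_link_append_block {t : ℕ} {s s' : Option Bool} (l : Link s s') (b : Block t s')
    (y : Bool) : y ∈ l.word ++ b.word := by
  match s, s', b, l with
  | none, none, _, x => cases x <;> cases y <;> simp [Link.word]
  | none, some x, _, _ => cases x <;> cases y <;> simp [Link.word]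
  | some x, none, j, _ => cases x <;> cases y <;> simp [Link.word]
  | some x, some z, j, _ => cases x <;> cases y <;> cases z <;> simp [Link.word, Block.word]

/-- Between given blocks, the link is determined modulo `∼₂`. -/
theorem Link.eq_of_scatFactLE_eq {t n : ℕ} (hn : 2 ≤ n) {s s' : Option Bool} {l l' : Link s s'}
    {b : Block t s} {b' : Block t s'}
    (h : scatFactLE n (b.word ++ l.word ++ b'.word) =
      scatFactLE n (b.word ++ l'.word ++ b'.word)) : l = l' := by
  match s, s', b, b', l, l' with
  | none, some _, _, _, _, _ => rfl
  | some _, _, _, _, _, _ => rfl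
  | none, none, _, _, x, y =>
    -- Both blocks are empty, so the link is the whole word and, having length 2, is visible modulo
    -- `∼_n`.
    have h2 := (h.le ⟨List.Sublist.refl _, hn⟩).1
    exact List.head_eq_of_cons_eq (h2.eq_of_length rfl)

/-! ### Uniqueness and existence of normal forms. -/

namespace NormalForm

variable {t : ℕ}

theorem hasArches_word : ∀ {m : ℕ} {s : Option Bool} (c : NormalForm t m s), HasArches c.word m
  | 0, _, c => hasArches_zero_iff.2 (Block.exists_notMem_word c)
  | m + 1, _, c => by
    have := (hasArches_word c.2.2.2).arch_append (isArch_block_append_link c.1 c.2.2.1)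
    rwa [List.append_assoc] at this

/-- After its first block, the word of a normal form with `m` links contains all words of
length `m`. -/
theorem append_sublist_append_word : ∀ {m : ℕ} {s : Option Bool} (c : NormalForm t m s)
    {X v u : List Bool}, u.length = m → v.Sublist (X ++ c.head.word) →
    (v ++ u).Sublist (X ++ c.word)
  | 0, _, c, X, v, u, hu, hv => by
    obtain rfl := List.length_eq_zero_iff.1 hu
    simpa [head, word] using hv
  | m + 1, _, c, X, v, [], hu, hv => by simp at hu
  | m + 1, _, c, X, v, r :: u, hu, hv => by
    -- The link with the following block contains every letter, so it absorbs `r`; the induction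
    -- then runs with `X` enlarged by the first block and the link.
    have h1 : (v ++ [r]).Sublist ((X ++ c.1.word ++ c.2.2.1.word) ++ c.2.2.2.head.word) := by
      rw [List.append_assoc]
      exact List.Sublist.append hv
        (List.singleton_sublist.2 (mem_link_append_block c.2.2.1 c.2.2.2.head r))
    have h2 := append_sublist_append_word c.2.2.2 (u := u) (by simpa using hu) h1
    simpa [word] using h2

/-- The rightmost embedding of a suitable word of length `m` into the word of a normal form leaves
exactly the first block free. -/
theorem exists_append_sublist_iff : ∀ {m : ℕ} {s : Option Bool} (c : NormalForm t m s),
    ∃ u : List Bool, u.length = m ∧ ∀ X v : List Bool,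
      (v ++ u).Sublist (X ++ c.word) ↔ v.Sublist (X ++ c.head.word)
  | 0, _, c => ⟨[], rfl, fun X v => by simp [head, word]⟩
  | m + 1, _, c => by
    obtain ⟨u, hu, h⟩ := exists_append_sublist_iff c.2.2.2
    -- The word sought consists of the first letters of the right-to-left arches. As `r` does not
    -- recur in its arch, matching it there pushes everything earlier in front of the link.
    obtain ⟨r, z, hrz, hr⟩ := exists_link_append_block c.2.2.1 c.2.2.2.head
    refine ⟨r :: u, by simp [hu], fun X v => ⟨fun hv => ?_, fun hv =>
      append_sublist_append_word c (by simp [hu]) hv⟩⟩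
    have h1 := (h (X ++ c.1.word ++ c.2.2.1.word) (v ++ [r])).1 (by simpa [word] using hv)
    rw [List.append_assoc _ c.2.2.1.word, hrz] at h1
    exact h1.of_append_singleton_of_notMem hr

/-- Append to `v` the word of length `m` that is tight for `c'`: it always fits on the left-hand
side, and on the right-hand side it leaves only `X'` and the first block for `v`. The prefixes are
needed to recover links as well as blocks. -/
theorem scatFactLE_head_subset {m n : ℕ} {s s' : Option Bool} {c : NormalForm t m s}
    {c' : NormalForm t m s'} {X X' : List Bool}
    (h : scatFactLE (m + n) (X ++ c.word) ⊆ scatFactLE (m + n) (X' ++ c'.word)) :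
    scatFactLE n (X ++ c.head.word) ⊆ scatFactLE n (X' ++ c'.head.word) := by
  rintro v ⟨hv, hlen⟩
  obtain ⟨u, hu, hc'⟩ := exists_append_sublist_iff c'
  exact ⟨(hc' X' v).1 (h ⟨append_sublist_append_word c hu hv, by simp; omega⟩).1, hlen⟩

theorem scatFactLE_head_eq {m n : ℕ} {s s' : Option Bool} {c : NormalForm t m s}
    {c' : NormalForm t m s'} {X X' : List Bool}
    (h : scatFactLE (m + n) (X ++ c.word) = scatFactLE (m + n) (X' ++ c'.word)) :
    scatFactLE n (X ++ c.head.word) = scatFactLE n (X' ++ c'.head.word) :=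
  (scatFactLE_head_subset h.le).antisymm (scatFactLE_head_subset h.ge)

/-- Normal forms with congruent words are equal. -/
theorem eq_of_scatFactLE_eq (ht : 0 < t) : ∀ {m : ℕ} {s s' : Option Bool} (c : NormalForm t m s)
    (c' : NormalForm t m s'), scatFactLE (m + t) c.word = scatFactLE (m + t) c'.word →
    (⟨s, c⟩ : Σ s, NormalForm t m s) = ⟨s', c'⟩
  | 0, s, s', c, c', h => by
    rw [zero_add] at h
    exact Block.eq_of_word_eq (_root_.eq_of_scatFactLE_eq (Block.length_word_le _)
      (Block.length_word_le _) h)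
  | m + 1, s, s', (b, ⟨s₁, l, d⟩), (b', ⟨s₁', l', d'⟩), h => by
    have hb : b.word = b'.word :=
      _root_.eq_of_scatFactLE_eq b.length_word_le b'.length_word_le
        (scatFactLE_head_eq (X := []) (X' := []) h)
    obtain ⟨rfl, hb'⟩ := Sigma.mk.inj_iff.1 (Block.eq_of_word_eq hb)
    obtain rfl := eq_of_heq hb'
    simp only [word, ← List.append_assoc] at h
    rw [Nat.add_right_comm] at h
    -- The links may still differ here, but each completes the block to an arch, and cancelling
    -- first arches does not require them to be equal.
    obtain ⟨rfl, hd⟩ := Sigma.mk.inj_iff.1 (eq_of_scatFactLE_eq ht d d'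
      (scatFactLE_of_isArch_append (isArch_block_append_link b l)
        (isArch_block_append_link b l') h))
    obtain rfl := eq_of_heq hd
    rw [add_assoc] at h
    -- Now the prefix is the first block with its link, and `n = t + 1`, which is at least 2 because
    -- `t > 0`.
    have h2 := scatFactLE_head_eq h
    rw [Link.eq_of_scatFactLE_eq (by omega) h2]

theorem link_append_word_sublist {m : ℕ} {s s' : Option Bool} (l : Link s s')
    (d : NormalForm t m s') {u : List Bool} (hu : u.length = m + 1) :
    u.Sublist (l.word ++ d.word) := by
  cases u with
  | nil => simp at hu
  | cons r u =>
    exact append_sublist_append_word d (v := [r]) (by simpa using hu)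
      (List.singleton_sublist.2 (mem_link_append_block l d.head r))

theorem exists_block_scatFactLE_eq (ht : 0 < t) {n : ℕ} {x : Bool} {i : ℕ} {S : List Bool}
    (hS : ∀ u : List Bool, u.length = n → u.Sublist S) :
    ∃ b : Block t (some x), scatFactLE (n + t) (b.word ++ S) =
      scatFactLE (n + t) (List.replicate (i + 1) x ++ S) := by
  rcases lt_or_ge i t with hi | hi
  · exact ⟨(⟨i, hi⟩ : Fin t), rfl⟩
  -- The index `t - 1` stands for the exponent `t`.
  · refine ⟨(⟨t - 1, by omega⟩ : Fin t), ?_⟩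
    refine (scatFactLE_replicate_append hS ?_ ?_).symm
    · show t ≤ t - 1 + 1
      omega
    · show t - 1 + 1 ≤ i + 1
      omega

/-- Every word with `m` arches is congruent to the word of a normal form. -/
theorem exists_scatFactLE_eq (ht : 0 < t) : ∀ {m : ℕ} {w : List Bool}, HasArches w m →
    ∃ (s : Option Bool) (c : NormalForm t m s),
      scatFactLE (m + t) c.word = scatFactLE (m + t) w
  | 0, w, h => by
    obtain ⟨y, hy⟩ := hasArches_zero_iff.1 h
    have hw : w = List.replicate w.length (!y) := List.eq_replicate_iff.2 ⟨rfl, fun b hb => by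
      have : b ≠ y := fun h => hy (h ▸ hb)
      cases b <;> cases y <;> simp_all⟩
    cases hn : w.length with
    | zero => exact ⟨none, (), by rw [List.length_eq_zero_iff.1 hn]; rfl⟩
    | succ i =>
      obtain ⟨b, hb⟩ := exists_block_scatFactLE_eq ht (n := 0) (x := !y) (i := i) (S := [])
        (by simp)
      rw [List.append_nil, List.append_nil, ← hn, ← hw] at hb
      exact ⟨some (!y), b, hb⟩
  | m + 1, w, h => by
    obtain ⟨a, w', rfl, ha, hw'⟩ := h.exists_eq_append
    obtain ⟨s', d, hd⟩ := exists_scatFactLE_eq ht hw'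
    have h1 := scatFactLE_append_congr ha.1 hd
    rw [Nat.add_right_comm] at h1
    rw [← h1]
    obtain ⟨x, j, rfl⟩ := ha.exists_eq_replicate
    -- The arch is `x^(j+1)` followed by `!x`. If the tail starts with a power of `x`, the link is
    -- `!x` alone and the block takes all `j + 1` copies of `x`. Otherwise the last `x` belongs to
    -- the link and the block is `x^j`, which is empty for `j = 0`.
    by_cases hs' : s' = some x
    · subst hs'
      let l : Link (some x) (some x) := ()
      obtain ⟨b, hb⟩ := exists_block_scatFactLE_eq ht (x := x) (i := j)
        (fun _ => link_append_word_sublist l d)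
      refine ⟨some x, (b, ⟨some x, l, d⟩), hb.trans ?_⟩
      simp [Link.word]
    · have hlink : ∃ l : Link (some x) s', l.word = [x, !x] := by
        match s' with
        | none => exact ⟨(), rfl⟩
        | some y =>
          refine ⟨(), ?_⟩
          cases x <;> cases y <;> simp_all [Link.word]
      obtain ⟨l, hl⟩ := hlink
      cases j with
      | succ j =>
        obtain ⟨b, hb⟩ := exists_block_scatFactLE_eq ht (x := x) (i := j)
          (fun _ => link_append_word_sublist l d)
        refine ⟨some x, (b, ⟨s', l, d⟩), hb.trans ?_⟩
        rw [hl, List.replicate_succ' (n := j + 1)]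
        simp
      | zero =>
        have hlink' : ∃ l : Link none s', l.word = [x, !x] := by
          match s' with
          | none => exact ⟨x, rfl⟩
          | some y =>
            refine ⟨(), ?_⟩
            cases x <;> cases y <;> simp_all [Link.word]
        obtain ⟨l', hl'⟩ := hlink'
        refine ⟨none, ((), ⟨s', l', d⟩), ?_⟩
        simp [word, Block.word, hl']

end NormalForm

/-! ### Counting normal forms -/

instance Block.instFintype (t : ℕ) : (s : Option Bool) → Fintype (Block t s)
  | none => inferInstanceAs (Fintype Unit)
  | some _ => inferInstanceAs (Fintype (Fin t))

instance Link.instFintype : (s s' : Option Bool) → Fintype (Link s s')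
  | none, none => inferInstanceAs (Fintype Bool)
  | none, some _ => inferInstanceAs (Fintype Unit)
  | some _, _ => inferInstanceAs (Fintype Unit)

instance NormalForm.instFintype (t : ℕ) : (m : ℕ) → (s : Option Bool) →
    Fintype (NormalForm t m s)
  | 0, s => Block.instFintype t s
  | m + 1, s =>
    have := NormalForm.instFintype t m
    inferInstanceAs (Fintype (Block t s × (Σ s', Link s s' × NormalForm t m s')))

theorem Block.card_none (t : ℕ) : Fintype.card (Block t none) = 1 := rfl

theorem Block.card_some (t : ℕ) (x : Bool) : Fintype.card (Block t (some x)) = t :=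
  Fintype.card_fin t

theorem Link.card_none_none : Fintype.card (Link none none) = 2 := rfl

theorem Link.card_none_some (x : Bool) : Fintype.card (Link none (some x)) = 1 := rfl

theorem Link.card_some (x : Bool) (s : Option Bool) : Fintype.card (Link (some x) s) = 1 := rfl

theorem NormalForm.card_succ (t m : ℕ) (s : Option Bool) :
    Fintype.card (NormalForm t (m + 1) s) = Fintype.card (Block t s) *
      ∑ s', Fintype.card (Link s s') * Fintype.card (NormalForm t m s') := by
  have : Fintype.card (NormalForm t (m + 1) s) =
      Fintype.card (Block t s × (Σ s', Link s s' × NormalForm t m s')) := rfl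
  rw [this, Fintype.card_prod, Fintype.card_sigma]
  simp only [Fintype.card_prod]

/-- The entries of `archMatrix k m ^ n` applied to `archVector k m` count the normal forms by the
shape of their first block. -/
theorem archMatrix_pow_mulVec (k m : ℕ) (hmk : m ≤ k) (n : ℕ) :
    Matrix.mulVec (archMatrix k m ^ n) (archVector k m) =
      ![(Fintype.card (NormalForm (k - m) n (some true)) : ℝ),
        (Fintype.card (NormalForm (k - m) n none) : ℝ),
        (Fintype.card (NormalForm (k - m) n (some false)) : ℝ)] := by
  induction n with
  | zero =>
    have h (s) : Fintype.card (NormalForm (k - m) 0 s) = Fintype.card (Block (k - m) s) := rfl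
    simp [h, Block.card_none, Block.card_some, archVector, Nat.cast_sub hmk]
  | succ n ih =>
    rw [pow_succ', ← Matrix.mulVec_mulVec, ih]
    simp only [NormalForm.card_succ, Fintype.sum_option, Fintype.sum_bool, Block.card_none,
      Block.card_some, Link.card_none_none, Link.card_none_some, Link.card_some]
    ext i
    fin_cases i <;>
      simp [archMatrix, Matrix.mulVec, dotProduct, Fin.sum_univ_three, Nat.cast_sub hmk] <;> ring

theorem norm_archMatrix_pow_mulVec (k m : ℕ) (hmk : m ≤ k) (n : ℕ) :
    ‖WithLp.toLp 1 (Matrix.mulVec (archMatrix k m ^ n) (archVector k m))‖ =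
      Fintype.card (Σ s, NormalForm (k - m) n s) := by
  rw [archMatrix_pow_mulVec k m hmk, PiLp.norm_eq_of_nat 1 (by simp), Fintype.card_sigma,
    Fintype.sum_option, Fintype.sum_bool]
  simp [Fin.sum_univ_three]
  ring

/-- The numbers `c_{t+m}^m` count the normal forms with `m` links. -/
theorem NormalForm.archRecAux_eq_card (t m : ℕ) :
    archRecAux ((t : ℤ) + m) (m + 1) = Fintype.card (Σ s, NormalForm t m s) ∧
    (Fintype.card (NormalForm t m none) : ℤ) =
      archRecAux ((t : ℤ) + m) (m + 1) - 2 * t * archRecAux ((t : ℤ) + m - 1) m := by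
  induction m with
  | zero =>
    have h (s) : Fintype.card (NormalForm t 0 s) = Fintype.card (Block t s) := rfl
    rw [Fintype.card_sigma, Fintype.sum_option, Fintype.sum_bool]
    -- The convention c_k^{-1} = 1 makes the second identity true at the start: 1 = (2t + 1) - 2t.
    simp [h, Block.card_none, Block.card_some, archRecAux]
    ring
  | succ m ih =>
    obtain ⟨h1, h2⟩ := ih
    have e1 : (t : ℤ) + (m + 1 : ℕ) - 1 = t + m := by push_cast; ring
    have e2 : (t : ℤ) + (m + 1 : ℕ) - 2 = t + m - 1 := by push_cast; ring
    have h3 : archRecAux ((t : ℤ) + (m + 1 : ℕ)) (m + 1 + 1) =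
        2 * (t + 1) * archRecAux ((t : ℤ) + m) (m + 1) -
          2 * t * archRecAux ((t : ℤ) + m - 1) m := by
      rw [archRecAux, e1, e2]
      push_cast
      ring
    rw [h3, e1]
    rw [Fintype.card_sigma, Fintype.sum_option, Fintype.sum_bool] at h1 ⊢
    simp only [NormalForm.card_succ, Fintype.sum_option, Fintype.sum_bool, Block.card_none,
      Block.card_some, Link.card_none_none, Link.card_none_some, Link.card_some]
    push_cast at h1 ⊢
    -- Let T be the total count and N the count with empty first block. One more link gives T' = (2t
    -- + 1)T + N and N' = T + N, hence N' = T' - 2tT. This relation is the second identity, and it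
    -- eliminates N from the first.
    constructor
    · linear_combination (2 * (t : ℤ) + 1) * h1 - h2
    · linear_combination h2 - h1

/-! ### The count for an arbitrary two-letter alphabet. -/

theorem mainTheorem4 {A : Type*} (hA : Nat.card A = 2) (k m : ℕ) (hmk : m < k) :
    (simonClasses A k m).Finite ∧
    ((simonClasses A k m).ncard : ℝ) =
      ‖WithLp.toLp 1 (Matrix.mulVec (archMatrix k m ^ m) (archVector k m))‖ ∧
    ‖WithLp.toLp 1 (Matrix.mulVec (archMatrix k m ^ m) (archVector k m))‖ =
      ((archRec (k : ℤ) (m : ℤ) : ℤ) : ℝ) := by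
  have hfin : Finite A := Nat.finite_of_card_ne_zero (by omega)
  obtain ⟨e⟩ : Nonempty (Bool ≃ A) :=
    (Finite.card_eq).1 (by rw [hA, Nat.card_eq_fintype_card, Fintype.card_bool])
  -- From here on k - m is `t + 1`, so the exponent bound of the normal forms is positive.
  obtain ⟨t, rfl⟩ := Nat.exists_eq_add_of_lt hmk
  have ht : m + t + 1 = m + (t + 1) := by ring
  have hsub : m + (t + 1) - m = t + 1 := by omega
  rw [ht]
  let f : (Σ s, NormalForm (t + 1) m s) → Quotient (simonSetoid A (m + (t + 1))) :=
    fun c => Quotient.mk _ (c.2.word.map e)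
  have hf : Function.Injective f := by
    rintro ⟨s, c⟩ ⟨s', c'⟩ h
    exact NormalForm.eq_of_scatFactLE_eq t.succ_pos c c'
      ((scatFactLE_map_inj e).1 (Quotient.exact h))
  have hrange : simonClasses A (m + (t + 1)) m = Set.range f := by
    ext q
    constructor
    · rintro ⟨w, hw, rfl⟩
      obtain ⟨s, c, hc⟩ := NormalForm.exists_scatFactLE_eq t.succ_pos (hw.map e.symm)
      refine ⟨⟨s, c⟩, Quotient.sound ?_⟩
      have := (scatFactLE_map_inj e).2 hc
      rwa [List.map_map, e.self_comp_symm, List.map_id] at this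
    · rintro ⟨c, rfl⟩
      exact ⟨_, c.2.hasArches_word.map e, rfl⟩
  have hnorm := norm_archMatrix_pow_mulVec (m + (t + 1)) m (by omega) m
  rw [hsub] at hnorm
  refine ⟨hrange ▸ Set.finite_range f, ?_, ?_⟩
  · rw [hnorm, hrange, ← Set.image_univ, Set.ncard_image_of_injective _ hf, Set.ncard_univ,
      Nat.card_eq_fintype_card]
  · rw [hnorm, archRec, show ((m : ℤ) + 1).toNat = m + 1 by omega,
      show ((m + (t + 1) : ℕ) : ℤ) = ((t + 1 : ℕ) : ℤ) + m by push_cast; ring,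
      (NormalForm.archRecAux_eq_card (t + 1) m).1]
    simp
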